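/- Throughout, let $\epsilon\in\{-1,1\}$. An $\epsilon$-Kähler manifold $(M,J,g)$ is a (smooth, Hausdorff) pseudo-Riemannian manifold $(M,g)$ with a smooth endomorphism field $J\in\Gamma(\operatorname{End}TM)$ such that $J^2=\epsilon\,\mathrm{Id}$, $J$ is skew-symmetric with respect to $g$, and $DJ=0$, where $D$ denotes the Levi-Civita connection of $g$; its Kähler form is $\omega=\epsilon\, g(J\cdot,\cdot)$. An affine special $\epsilon$-Kähler manifold $(M,J,g,\nabla)$ is an $\epsilon$-Kähler manifold $(M,J,g)$ with a flat torsion-free connection $\nabla$ on $TM$ such that $\nabla\omega=0$ and $(\nabla_XJ)Y=(\nabla_YJ)X$ for all vector fields $X,Y$. It is called conical, with data $(M,J,g,\nabla,\xi)$, if it is endowed with a vector field $\xi$ such that $\nabla\xi=D\xi=\mathrm{Id}$. **Proposition.** Let $(M,J,g,\nabla,\xi)$ be a conical affine special $\epsilon$-Kähler manifold, and let $\nabla^J:=J\circ\nabla\circ J^{-1}$, i.e. $\nabla^J_XY=J\,\nabla_X(J^{-1}Y)$. Then $(M,J,g,\nabla^J,\xi)$ is a conical affine special $\epsilon$-Kähler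 manifold. -/

import Mathlib

open Bundle Manifold VectorField FiberBundle
open scoped ContDiff Topology

noncomputable section

namespace SpecialGeometry

/-! `M` is a smooth manifold (without boundary) of dimension `m`. -/

variable {m : ℕ} {M : Type*} [TopologicalSpace M] [ChartedSpace (EuclideanSpace ℝ (Fin m)) M]
  [IsManifold (𝓡 m) ∞ M]

variable (m M) in
/-- Smooth vector fields on `M`. -/
abbrev SmoothVectorField : Type _ :=
  ContMDiffSection (𝓡 m) (EuclideanSpace ℝ (Fin m)) ∞ (TangentSpace (𝓡 m) : M → Type _)

variable (m M) in
/-- Smooth endomorphism fields, i.e. smooth sections of `End TM`. -/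
abbrev EndField : Type _ :=
  ContMDiffSection (𝓡 m) (EuclideanSpace ℝ (Fin m) →L[ℝ] EuclideanSpace ℝ (Fin m)) ∞
    (fun x : M ↦ TangentSpace (𝓡 m) x →L[ℝ] TangentSpace (𝓡 m) x)

variable (m M) in
/-- Connections (covariant derivatives) on the tangent bundle of `M`. For a connection `D`, a
vector field `Y` and a tangent vector `v` at `x`, `D Y x v` is `(D_v Y)(x)`. -/
abbrev Connection : Type _ :=
  CovariantDerivative (𝓡 m) (EuclideanSpace ℝ (Fin m)) (TangentSpace (𝓡 m) : M → Type _)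

variable (m M) in
/-- Pseudo-Riemannian metrics on `M`: smooth, symmetric, fibrewise nondegenerate `(0,2)`-tensor
fields. -/
structure PseudoRiemannianMetric where
  inner : ∀ x : M, TangentSpace (𝓡 m) x →L[ℝ] TangentSpace (𝓡 m) x →L[ℝ] ℝ
  symm : ∀ (x : M) (v w : TangentSpace (𝓡 m) x), inner x v w = inner x w v
  nondegenerate : ∀ (x : M) (v : TangentSpace (𝓡 m) x), (∀ w, inner x v w = 0) → v = 0
  contMDiff : ContMDiff (𝓡 m)
    ((𝓡 m).prod 𝓘(ℝ, EuclideanSpace ℝ (Fin m) →L[ℝ] EuclideanSpace ℝ (Fin m) →L[ℝ] ℝ)) ∞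
    (fun x ↦ TotalSpace.mk' (EuclideanSpace ℝ (Fin m) →L[ℝ] EuclideanSpace ℝ (Fin m) →L[ℝ] ℝ)
      (E := fun x : M ↦ TangentSpace (𝓡 m) x →L[ℝ] TangentSpace (𝓡 m) x →L[ℝ] ℝ) x (inner x))

/-- Differentiability of a vector field at a point. -/
abbrev DiffAt (X : ∀ x : M, TangentSpace (𝓡 m) x) (x : M) : Prop :=
  MDifferentiableAt (𝓡 m) ((𝓡 m).prod 𝓘(ℝ, EuclideanSpace ℝ (Fin m)))
    (fun y ↦ TotalSpace.mk' (EuclideanSpace ℝ (Fin m)) y (X y)) x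

/-! ### The Levi-Civita connection -/

namespace PseudoRiemannianMetric

variable (g : PseudoRiemannianMetric m M)

/-- The right-hand side of the Koszul formula `2 g(D_X Y, Z) = …`. -/
def koszul (X Y Z : ∀ x : M, TangentSpace (𝓡 m) x) (x : M) : ℝ :=
  (mvfderiv (𝓡 m) (fun y ↦ g.inner y (Y y) (Z y)) x) (X x)
    + (mvfderiv (𝓡 m) (fun y ↦ g.inner y (Z y) (X y)) x) (Y x)
    - (mvfderiv (𝓡 m) (fun y ↦ g.inner y (X y) (Y y)) x) (Z x)
    + g.inner x (mlieBracket (𝓡 m) X Y x) (Z x)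
    - g.inner x (mlieBracket (𝓡 m) Y Z x) (X x)
    + g.inner x (mlieBracket (𝓡 m) Z X x) (Y x)

variable {g} in
theorem mdiffAt_inner {X Y : ∀ x : M, TangentSpace (𝓡 m) x} {x : M}
    (hX : DiffAt X x) (hY : DiffAt Y x) :
    MDifferentiableAt (𝓡 m) 𝓘(ℝ) (fun y ↦ g.inner y (X y) (Y y)) x := by
  have h := (g.contMDiff.mdifferentiable (by simp)) x
  have := MDifferentiableAt.clm_bundle_apply₂ (F₃ := ℝ) (E₃ := Bundle.Trivial M ℝ)
    (b := fun y : M ↦ y) h hX hY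
  simp only [mdifferentiableAt_totalSpace] at this
  exact this.2

theorem koszul_tensorial_left {Y Z : ∀ x : M, TangentSpace (𝓡 m) x} {x : M}
    (hY : DiffAt Y x) (hZ : DiffAt Z x) :
    TensorialAt (𝓡 m) (EuclideanSpace ℝ (Fin m)) (fun X ↦ g.koszul X Y Z x) x where
  smul {f X} hf hX := by
    have h1 := mdiffAt_inner (g := g) hZ hX
    have h2 := mdiffAt_inner (g := g) hX hY
    simp [koszul, mlieBracket_smul_left hf hX, mlieBracket_smul_right hf hX,
      mvfderiv_fun_mul hf h1, mvfderiv_fun_mul hf h2]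
    rw [g.symm x (Z x) (X x)]
    ring
  add {X X'} hX hX' := by
    have h1 := mdiffAt_inner (g := g) hZ hX
    have h2 := mdiffAt_inner (g := g) hX hY
    have h1' := mdiffAt_inner (g := g) hZ hX'
    have h2' := mdiffAt_inner (g := g) hX' hY
    simp [koszul, mlieBracket_add_left hX hX', mlieBracket_add_right hX hX',
      mvfderiv_fun_add h1 h1', mvfderiv_fun_add h2 h2']
    ring

theorem koszul_tensorial_right {X Y : ∀ x : M, TangentSpace (𝓡 m) x} {x : M}
    (hX : DiffAt X x) (hY : DiffAt Y x) :
    TensorialAt (𝓡 m) (EuclideanSpace ℝ (Fin m)) (fun Z ↦ g.koszul X Y Z x) x where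
  smul {f Z} hf hZ := by
    have h1 := mdiffAt_inner (g := g) hZ hX
    have h2 := mdiffAt_inner (g := g) hY hZ
    simp [koszul, mlieBracket_smul_left hf hZ, mlieBracket_smul_right hf hZ,
      mvfderiv_fun_mul hf h1, mvfderiv_fun_mul hf h2]
    rw [g.symm x (Z x) (Y x)]
    ring
  add {Z Z'} hZ hZ' := by
    have h1 := mdiffAt_inner (g := g) hZ hX
    have h2 := mdiffAt_inner (g := g) hY hZ
    have h1' := mdiffAt_inner (g := g) hZ' hX
    have h2' := mdiffAt_inner (g := g) hY hZ'
    simp [koszul, mlieBracket_add_left hZ hZ', mlieBracket_add_right hZ hZ',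
      mvfderiv_fun_add h1 h1', mvfderiv_fun_add h2 h2']
    ring

theorem isInvertible_inner (x : M) : (g.inner x).IsInvertible := by
  have hfin : FiniteDimensional ℝ (TangentSpace (𝓡 m) x) :=
    inferInstanceAs (FiniteDimensional ℝ (EuclideanSpace ℝ (Fin m)))
  have hT2 : T2Space (TangentSpace (𝓡 m) x) :=
    inferInstanceAs (T2Space (EuclideanSpace ℝ (Fin m)))
  let f : TangentSpace (𝓡 m) x →ₗ[ℝ] TangentSpace (𝓡 m) x →L[ℝ] ℝ := g.inner x
  have hf : Function.Injective f := by
    rw [injective_iff_map_eq_zero]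
    intro v hv
    exact g.nondegenerate x v fun w ↦ congr($hv w)
  have hrank : Module.finrank ℝ (TangentSpace (𝓡 m) x)
      = Module.finrank ℝ (TangentSpace (𝓡 m) x →L[ℝ] ℝ) := by
    rw [← LinearMap.toContinuousLinearMap.finrank_eq]
    exact (Subspace.dual_finrank_eq).symm
  let e := (LinearEquiv.ofInjectiveOfFinrankEq f hf hrank).toContinuousLinearEquiv
  exact ⟨e, by ext; rfl⟩

open scoped Classical in
/-- The underlying operator of the Levi-Civita connection: for a vector field `Y` differentiable at
`x` and a tangent vector `v` at `x`, it is the vector `D_v Y` determined by the Koszul formula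
`2 g(D_v Y, w) = koszul (v, Y, w)`. -/
def leviCivitaAux (Y : ∀ x : M, TangentSpace (𝓡 m) x) (x : M) :
    TangentSpace (𝓡 m) x →L[ℝ] TangentSpace (𝓡 m) x :=
  if hY : DiffAt Y x then
    (1 / 2 : ℝ) • (g.inner x).inverse ∘L
      TensorialAt.mkHom₂ (fun X Z ↦ g.koszul X Y Z x) x
        (fun _ hZ ↦ g.koszul_tensorial_left hY hZ) (fun _ hX ↦ g.koszul_tensorial_right hX hY)
  else 0

theorem leviCivitaAux_koszul {X Y Z : ∀ x : M, TangentSpace (𝓡 m) x} {x : M}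
    (hX : DiffAt X x) (hY : DiffAt Y x) (hZ : DiffAt Z x) :
    2 * g.inner x (g.leviCivitaAux Y x (X x)) (Z x) = g.koszul X Y Z x := by
  have h := TensorialAt.mkHom₂_apply (Φ := fun X Z ↦ g.koszul X Y Z x)
    (fun _ hZ ↦ g.koszul_tensorial_left hY hZ) (fun _ hX ↦ g.koszul_tensorial_right hX hY) hX hZ
  rw [leviCivitaAux, dif_pos hY]
  simp only [smul_apply, ContinuousLinearMap.comp_apply, map_smul,
    (g.isInvertible_inner x).self_apply_inverse, h, smul_eq_mul]
  ring

theorem ext_inner {x : M} {v v' : TangentSpace (𝓡 m) x}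
    (h : ∀ Z : ∀ y : M, TangentSpace (𝓡 m) y, DiffAt Z x →
      g.inner x v (Z x) = g.inner x v' (Z x)) : v = v' := by
  rw [← sub_eq_zero]
  refine g.nondegenerate x _ fun w ↦ ?_
  have := h (extend (EuclideanSpace ℝ (Fin m)) w) (mdifferentiableAt_extend ..)
  simp at this
  simp [this]

/-- The Levi-Civita connection of a pseudo-Riemannian metric. -/
def leviCivita : Connection m M where
  toFun := g.leviCivitaAux
  isCovariantDerivativeOnUniv :=
    { add := by
        intro Y Y' x hY hY' _
        ext v
        obtain ⟨X, hX, rfl⟩ : ∃ X : ∀ y : M, TangentSpace (𝓡 m) y, DiffAt X x ∧ X x = v :=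
          ⟨extend (EuclideanSpace ℝ (Fin m)) v, mdifferentiableAt_extend .., by simp⟩
        refine g.ext_inner fun Z hZ ↦ ?_
        have e1 := g.leviCivitaAux_koszul hX hY hZ
        have e2 := g.leviCivitaAux_koszul hX hY' hZ
        have e3 := g.leviCivitaAux_koszul hX (mdifferentiableAt_add_section hY hY') hZ
        have h1 := mdiffAt_inner (g := g) hY hZ
        have h2 := mdiffAt_inner (g := g) hX hY
        have h1' := mdiffAt_inner (g := g) hY' hZ
        have h2' := mdiffAt_inner (g := g) hX hY'
        simp only [add_apply, map_add]
        have : g.koszul X (Y + Y') Z x = g.koszul X Y Z x + g.koszul X Y' Z x := by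
          simp [koszul, mlieBracket_add_left hY hY', mlieBracket_add_right hY hY',
            mvfderiv_fun_add h1 h1', mvfderiv_fun_add h2 h2']
          ring
        linarith
      leibniz := by
        intro Y f x hY hf _
        ext v
        obtain ⟨X, hX, rfl⟩ : ∃ X : ∀ y : M, TangentSpace (𝓡 m) y, DiffAt X x ∧ X x = v :=
          ⟨extend (EuclideanSpace ℝ (Fin m)) v, mdifferentiableAt_extend .., by simp⟩
        refine g.ext_inner fun Z hZ ↦ ?_
        have e1 := g.leviCivitaAux_koszul hX hY hZ
        have e3 := g.leviCivitaAux_koszul hX (hf.smul_section hY) hZ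
        have h1 := mdiffAt_inner (g := g) hY hZ
        have h2 := mdiffAt_inner (g := g) hX hY
        have : g.koszul X (f • Y) Z x = f x * g.koszul X Y Z x
            + 2 * (mvfderiv (𝓡 m) f x (X x) * g.inner x (Y x) (Z x)) := by
          simp [koszul, mlieBracket_smul_left hf hY, mlieBracket_smul_right hf hY,
            mvfderiv_fun_mul hf h1, mvfderiv_fun_mul hf h2]
          rw [g.symm x (X x) (Y x)]
          ring
        simp
        linear_combination e3 / 2 - f x * e1 / 2 + this / 2 }

/-- The Levi-Civita connection is torsion-free. -/
theorem leviCivita_torsion : g.leviCivita.torsion = 0 := by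
  rw [CovariantDerivative.torsion_eq_zero_iff]
  intro X Y x hX hY
  refine g.ext_inner fun Z hZ ↦ ?_
  have e1 := g.leviCivitaAux_koszul hX hY hZ
  have e2 := g.leviCivitaAux_koszul hY hX hZ
  change g.inner x (g.leviCivitaAux Y x (X x) - g.leviCivitaAux X x (Y x)) (Z x) = _
  have s1 : (fun y ↦ g.inner y (Z y) (Y y)) = fun y ↦ g.inner y (Y y) (Z y) :=
    funext fun y ↦ g.symm ..
  have s2 : (fun y ↦ g.inner y (X y) (Z y)) = fun y ↦ g.inner y (Z y) (X y) :=
    funext fun y ↦ g.symm ..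
  have s3 : (fun y ↦ g.inner y (Y y) (X y)) = fun y ↦ g.inner y (X y) (Y y) :=
    funext fun y ↦ g.symm ..
  simp only [koszul, s1, s2, s3] at e1 e2
  rw [mlieBracket_swap_apply (V := Y) (W := X), mlieBracket_swap_apply (V := X) (W := Z),
    mlieBracket_swap_apply (V := Z) (W := Y)] at e2
  simp only [map_neg, neg_apply, map_sub, sub_apply] at e1 e2 ⊢
  linarith

/-- The Levi-Civita connection is metric. -/
theorem leviCivita_metric {X Y Z : ∀ x : M, TangentSpace (𝓡 m) x} {x : M}
    (hX : DiffAt X x) (hY : DiffAt Y x) (hZ : DiffAt Z x) :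
    mvfderiv (𝓡 m) (fun y ↦ g.inner y (Y y) (Z y)) x (X x)
      = g.inner x (g.leviCivita Y x (X x)) (Z x) + g.inner x (Y x) (g.leviCivita Z x (X x)) := by
  have e1 := g.leviCivitaAux_koszul hX hY hZ
  have e2 := g.leviCivitaAux_koszul hX hZ hY
  change _ = g.inner x (g.leviCivitaAux Y x (X x)) (Z x) + g.inner x (Y x) (g.leviCivitaAux Z x (X x))
  rw [g.symm x (Y x)]
  have s1 : (fun y ↦ g.inner y (Z y) (Y y)) = fun y ↦ g.inner y (Y y) (Z y) :=
    funext fun y ↦ g.symm ..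
  have s2 : (fun y ↦ g.inner y (X y) (Z y)) = fun y ↦ g.inner y (Z y) (X y) :=
    funext fun y ↦ g.symm ..
  have s3 : (fun y ↦ g.inner y (Y y) (X y)) = fun y ↦ g.inner y (X y) (Y y) :=
    funext fun y ↦ g.symm ..
  simp only [koszul, s1, s2, s3] at e1 e2
  rw [mlieBracket_swap_apply (V := Y) (W := X), mlieBracket_swap_apply (V := X) (W := Z),
    mlieBracket_swap_apply (V := Z) (W := Y)] at e2
  simp only [map_neg, neg_apply] at e1 e2
  linarith

end PseudoRiemannianMetric

/-! ### Tensor fields derived from a connection -/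

namespace EndField

/-- The pointwise inverse `J⁻¹` of an endomorphism field all of whose values are invertible. -/
def inv (J : EndField m M) (hJ : ∀ x, (J x).IsInvertible) : EndField m M where
  toFun x := (J x).inverse
  contMDiff_toFun := by
    intro x
    have h := J.contMDiff x
    rw [contMDiffAt_hom_bundle] at h ⊢
    refine ⟨h.1, ?_⟩
    set t := trivializationAt (EuclideanSpace ℝ (Fin m)) (TangentSpace (𝓡 m) : M → Type _) x
    have hx : x ∈ t.baseSet := mem_baseSet_trivializationAt' x
    have hinv : ∀ y ∈ t.baseSet, (ContinuousLinearMap.inCoordinates (EuclideanSpace ℝ (Fin m))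
        (TangentSpace (𝓡 m) : M → Type _) (EuclideanSpace ℝ (Fin m))
        (TangentSpace (𝓡 m) : M → Type _) x y x y (J y)).IsInvertible := by
      intro y hy
      rw [ContinuousLinearMap.inCoordinates_eq hy hy]
      obtain ⟨e, he⟩ := hJ y
      rw [← he]
      exact ⟨((t.continuousLinearEquivAt ℝ y hy).symm.trans e).trans
        (t.continuousLinearEquivAt ℝ y hy), by ext1 v; simp [t]⟩
    refine (((hinv x hx).contDiffAt_map_inverse (n := ∞)).contMDiffAt.comp x h.2).congr_of_eventuallyEq ?_
    filter_upwards [t.open_baseSet.mem_nhds hx] with y hy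
    simp only [Function.comp_apply]
    rw [ContinuousLinearMap.inCoordinates_eq hy hy, ContinuousLinearMap.inCoordinates_eq hy hy]
    obtain ⟨e, he⟩ := hJ y
    rw [← he]
    ext1 v
    simp

end EndField

/-- The connection `∇^J = J ∘ ∇ ∘ J⁻¹`, i.e. `∇^J_v Y = J (∇_v (J⁻¹ Y))`. -/
def conj (D : Connection m M) (J : EndField m M) (hJ : ∀ x, (J x).IsInvertible) :
    Connection m M where
  toFun Y x := (J x) ∘L D (fun y ↦ J.inv hJ y (Y y)) x
  isCovariantDerivativeOnUniv :=
    { add := by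
        intro Y Y' x hY hY' _
        have h := (J.inv hJ).contMDiff.mdifferentiable (by simp) x
        have e : (fun y ↦ J.inv hJ y ((Y + Y') y))
            = (fun y ↦ J.inv hJ y (Y y)) + fun y ↦ J.inv hJ y (Y' y) := by
          ext1 y; simp
        rw [e, D.isCovariantDerivativeOnUniv.add (h.clm_bundle_apply hY) (h.clm_bundle_apply hY')]
        simp
      leibniz := by
        intro Y f x hY hf _
        have h := (J.inv hJ).contMDiff.mdifferentiable (by simp) x
        have e : (fun y ↦ J.inv hJ y ((f • Y) y)) = f • fun y ↦ J.inv hJ y (Y y) := by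
          ext1 y; simp
        rw [e, D.isCovariantDerivativeOnUniv.leibniz (h.clm_bundle_apply hY) hf]
        ext v
        have : J x (J.inv hJ x (Y x)) = Y x := (hJ x).self_apply_inverse _
        simp [this] }

/-- The covariant derivative `(∇_X J) Y = ∇_X (J Y) - J (∇_X Y)` of an endomorphism field. -/
def covDerivEnd (D : Connection m M) (J : EndField m M) (X Y : SmoothVectorField m M) (x : M) :
    TangentSpace (𝓡 m) x :=
  D (fun y ↦ J y (Y y)) x (X x) - J x (D Y x (X x))

/-- The covariant derivative
`(∇_X b)(Y, Z) = X (b(Y, Z)) - b(∇_X Y, Z) - b(Y, ∇_X Z)` of a `(0,2)`-tensor field. -/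
def covDerivForm (D : Connection m M)
    (b : ∀ x : M, TangentSpace (𝓡 m) x →L[ℝ] TangentSpace (𝓡 m) x →L[ℝ] ℝ)
    (X Y Z : SmoothVectorField m M) (x : M) : ℝ :=
  mvfderiv (𝓡 m) (fun y ↦ b y (Y y) (Z y)) x (X x)
    - b x (D Y x (X x)) (Z x) - b x (Y x) (D Z x (X x))

/-- The curvature `R(X, Y) Z = ∇_X ∇_Y Z - ∇_Y ∇_X Z - ∇_[X, Y] Z`. -/
def curvature (D : Connection m M) (X Y Z : SmoothVectorField m M) (x : M) :
    TangentSpace (𝓡 m) x :=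
  D (fun y ↦ D Z y (Y y)) x (X x) - D (fun y ↦ D Z y (X y)) x (Y x)
    - D Z x (mlieBracket (𝓡 m) X Y x)

/-! ### Special `ε`-Kähler geometry -/

/-- `(M, J, g)` is an `ε`-Kähler manifold, `ε ∈ {-1, 1}`: the endomorphism field `J` satisfies
`J² = ε Id`, is skew-symmetric with respect to `g`, and is parallel with respect to the Levi-Civita
connection of `g`. -/
structure IsEpsKahler (ε : ℝ) (J : EndField m M) (g : PseudoRiemannianMetric m M) : Prop where
  eps : ε = -1 ∨ ε = 1
  sq : ∀ (x : M) (v : TangentSpace (𝓡 m) x), J x (J x v) = ε • v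
  skew : ∀ (x : M) (v w : TangentSpace (𝓡 m) x), g.inner x (J x v) w = -g.inner x v (J x w)
  parallel : ∀ (X Y : SmoothVectorField m M) (x : M), covDerivEnd g.leviCivita J X Y x = 0

/-- The Kähler form `ω = ε g(J ·, ·)`. -/
def kahlerForm (ε : ℝ) (J : EndField m M) (g : PseudoRiemannianMetric m M) (x : M) :
    TangentSpace (𝓡 m) x →L[ℝ] TangentSpace (𝓡 m) x →L[ℝ] ℝ :=
  ε • (g.inner x ∘L J x)

/-- `(M, J, g, ∇)` is an affine special `ε`-Kähler manifold: `(M, J, g)` is `ε`-Kähler and `∇` is a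
smooth flat torsion-free connection with `∇ω = 0` and `(∇_X J) Y = (∇_Y J) X`. -/
structure IsAffineSpecial (ε : ℝ) (J : EndField m M) (g : PseudoRiemannianMetric m M)
    (nabla : Connection m M) : Prop extends IsEpsKahler ε J g where
  smooth : CovariantDerivative.ContMDiffCovariantDerivative nabla ∞
  flat : ∀ (X Y Z : SmoothVectorField m M) (x : M), curvature nabla X Y Z x = 0
  torsion_free : nabla.torsion = 0
  symplectic : ∀ (X Y Z : SmoothVectorField m M) (x : M),
    covDerivForm nabla (kahlerForm ε J g) X Y Z x = 0
  symmetric : ∀ (X Y : SmoothVectorField m M) (x : M),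
    covDerivEnd nabla J X Y x = covDerivEnd nabla J Y X x

/-- `(M, J, g, ∇, ξ)` is a conical affine special `ε`-Kähler manifold: `(M, J, g, ∇)` is affine
special `ε`-Kähler and `∇ξ = Dξ = Id`, where `D` is the Levi-Civita connection of `g`. -/
structure IsConicalAffineSpecial (ε : ℝ) (J : EndField m M) (g : PseudoRiemannianMetric m M)
    (nabla : Connection m M) (ξ : SmoothVectorField m M) : Prop extends IsAffineSpecial ε J g nabla where
  nabla_xi : ∀ (x : M) (v : TangentSpace (𝓡 m) x), nabla ξ x v = v
  leviCivita_xi : ∀ (x : M) (v : TangentSpace (𝓡 m) x), g.leviCivita ξ x v = v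

theorem IsEpsKahler.isInvertible {ε : ℝ} {J : EndField m M} {g : PseudoRiemannianMetric m M}
    (h : IsEpsKahler ε J g) (x : M) : (J x).IsInvertible := by
  have h2 : ε * ε = 1 := by rcases h.eps with h | h <;> simp [h]
  refine ContinuousLinearMap.IsInvertible.of_inverse (g := ε • J x) ?_ ?_
  · ext1 v
    simp [h.sq, smul_smul, h2]
  · ext1 v
    simp [h.sq, smul_smul, h2]

end SpecialGeometry

end

open SpecialGeometry

noncomputable section

namespace SpecialGeometry

/-! ### Global smooth fields and pointwise tests. -/

variable {m : ℕ} {M : Type*} [TopologicalSpace M] [ChartedSpace (EuclideanSpace ℝ (Fin m)) M]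
  [IsManifold (𝓡 m) ∞ M]

/-! Conjugating by `J` preserves smoothness and flatness. Everything else rests on J⁻¹ = εJ, which
gives ∇^J_X Y = ∇_X Y + εJ(∇_X J)Y (`IsEpsKahler.conj_apply_eq_add`). Since (∇_X J)Y is symmetric in
X and Y, the torsion does not change; since ∇^J J = -∇J, the symmetry persists. As ω(J·, J·) = -εω
with a constant factor, ∇ω = 0 yields ∇^J ω = 0 (`IsEpsKahler.covDerivForm_conj`). For the cone
field, symmetry gives ∇^J_X ξ = X + εJ(∇_ξ J)X, so ∇_ξ J = 0 is needed. A torsion-free connection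
with ∇ξ = Id satisfies ∇_ξ J = L_ξ J (`covDerivEnd_eq_lieDerivative`). This applies to both ∇ and D,
and the Lie derivative involves no connection, so ∇_ξ J = D_ξ J = 0. -/

/-- On a Hausdorff manifold every tangent vector extends to a global smooth vector field. -/
theorem exists_smoothVectorField_eq [T2Space M] (x : M) (v : TangentSpace (𝓡 m) x) :
    ∃ X : SmoothVectorField m M, X x = v := by
  obtain ⟨s, hs, hv⟩ := exists_contMDiffOn_extend (k := ∞) (𝓡 m) (EuclideanSpace ℝ (Fin m)) v
  obtain ⟨u, hus, hu, hxu⟩ := mem_nhds_iff.mp hs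
  -- The local extension is smooth only on `u`; a bump function supported there cuts it off.
  obtain ⟨f, -, hf⟩ := ((SmoothBumpFunction.nhds_basis_tsupport (I := 𝓡 m) x).mem_iff).mp
    (hu.mem_nhds hxu)
  refine ⟨⟨(f : M → ℝ) • extend (EuclideanSpace ℝ (Fin m)) v, ?_⟩, ?_⟩
  · exact f.contMDiff.contMDiffOn.smul_section_of_tsupport hu hf (hv.mono hus)
  · change f x • extend (EuclideanSpace ℝ (Fin m)) v x = v
    simp

/-- The composition of two smooth fields of endomorphisms of `TM` is smooth. -/
theorem contMDiff_endomorphism_comp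
    {A B : ∀ x : M, TangentSpace (𝓡 m) x →L[ℝ] TangentSpace (𝓡 m) x}
    (hA : ContMDiff (𝓡 m)
      ((𝓡 m).prod 𝓘(ℝ, EuclideanSpace ℝ (Fin m) →L[ℝ] EuclideanSpace ℝ (Fin m))) ∞
      (fun x ↦ TotalSpace.mk' (EuclideanSpace ℝ (Fin m) →L[ℝ] EuclideanSpace ℝ (Fin m))
        (E := fun x : M ↦ TangentSpace (𝓡 m) x →L[ℝ] TangentSpace (𝓡 m) x) x (A x)))
    (hB : ContMDiff (𝓡 m)
      ((𝓡 m).prod 𝓘(ℝ, EuclideanSpace ℝ (Fin m) →L[ℝ] EuclideanSpace ℝ (Fin m))) ∞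
      (fun x ↦ TotalSpace.mk' (EuclideanSpace ℝ (Fin m) →L[ℝ] EuclideanSpace ℝ (Fin m))
        (E := fun x : M ↦ TangentSpace (𝓡 m) x →L[ℝ] TangentSpace (𝓡 m) x) x (B x))) :
    ContMDiff (𝓡 m)
      ((𝓡 m).prod 𝓘(ℝ, EuclideanSpace ℝ (Fin m) →L[ℝ] EuclideanSpace ℝ (Fin m))) ∞
      (fun x ↦ TotalSpace.mk' (EuclideanSpace ℝ (Fin m) →L[ℝ] EuclideanSpace ℝ (Fin m))
        (E := fun x : M ↦ TangentSpace (𝓡 m) x →L[ℝ] TangentSpace (𝓡 m) x) x (A x ∘L B x)) := by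
  intro x
  have hA := hA x
  have hB := hB x
  rw [contMDiffAt_hom_bundle] at hA hB ⊢
  refine ⟨hA.1, (hA.2.clm_comp hB.2).congr_of_eventuallyEq ?_⟩
  set t := trivializationAt (EuclideanSpace ℝ (Fin m)) (TangentSpace (𝓡 m) : M → Type _) x
  have hx : x ∈ t.baseSet := mem_baseSet_trivializationAt' x
  filter_upwards [t.open_baseSet.mem_nhds hx] with y hy
  rw [ContinuousLinearMap.inCoordinates_eq hy hy, ContinuousLinearMap.inCoordinates_eq hy hy,
    ContinuousLinearMap.inCoordinates_eq hy hy]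
  ext1 v
  -- Between the two factors the trivialization meets its own inverse and cancels.
  simp [t.symm_apply_apply_mk hy, t]

/-- The smooth vector field `J Y`. -/
def EndField.apply (J : EndField m M) (Y : SmoothVectorField m M) : SmoothVectorField m M where
  toFun x := J x (Y x)
  contMDiff_toFun := J.contMDiff.clm_bundle_apply Y.contMDiff

theorem SmoothVectorField.diffAt (X : SmoothVectorField m M) (x : M) : DiffAt X x :=
  X.contMDiff.mdifferentiable (by simp) x

/-- Torsion vanishes as soon as it vanishes on smooth vector fields. -/
theorem torsion_eq_zero_of_smooth [T2Space M] {D : Connection m M}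
    (h : ∀ (X Y : SmoothVectorField m M) (x : M),
      D Y x (X x) - D X x (Y x) = mlieBracket (𝓡 m) X Y x) : D.torsion = 0 := by
  ext1 x
  ext1 v
  ext1 w
  obtain ⟨X, rfl⟩ := exists_smoothVectorField_eq x v
  obtain ⟨Y, rfl⟩ := exists_smoothVectorField_eq x w
  rw [D.torsion_apply (X.diffAt x) (Y.diffAt x), h, sub_self]
  rfl

theorem sub_eq_mlieBracket_of_torsion {D : Connection m M} (h : D.torsion = 0)
    (X Y : SmoothVectorField m M) (x : M) :
    D Y x (X x) - D X x (Y x) = mlieBracket (𝓡 m) X Y x :=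
  (CovariantDerivative.torsion_eq_zero_iff D).mp h (X.diffAt x) (Y.diffAt x)

/-! ### Conjugation by an invertible endomorphism field. -/

section Conj

variable (D : Connection m M) (J : EndField m M) (hJ : ∀ x, (J x).IsInvertible)

theorem EndField.inv_apply_self (x : M) (v : TangentSpace (𝓡 m) x) :
    J.inv hJ x (J x v) = v :=
  (hJ x).inverse_apply_self v

theorem EndField.self_apply_inv (x : M) (v : TangentSpace (𝓡 m) x) :
    J x (J.inv hJ x v) = v :=
  (hJ x).self_apply_inverse v

theorem conj_apply (Y : ∀ x : M, TangentSpace (𝓡 m) x) (x : M) (v : TangentSpace (𝓡 m) x) :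
    conj D J hJ Y x v = J x (D (fun y ↦ J.inv hJ y (Y y)) x v) := rfl

/-- `J` intertwines the two connections; on fields of the form JY no inverse remains. -/
theorem conj_apply_apply (Y : ∀ x : M, TangentSpace (𝓡 m) x) (x : M)
    (v : TangentSpace (𝓡 m) x) :
    conj D J hJ (fun y ↦ J y (Y y)) x v = J x (D Y x v) := by
  simp only [conj_apply, EndField.inv_apply_self]

/-- The curvature of `∇^J` is the curvature of `∇` conjugated by `J`. -/
theorem curvature_conj (X Y Z : SmoothVectorField m M) (x : M) :
    curvature (conj D J hJ) X Y Z x = J x (curvature D X Y ((J.inv hJ).apply Z) x) := by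
  simp only [curvature, conj_apply, EndField.inv_apply_self, map_sub]
  rfl

theorem contMDiff_conj (h : CovariantDerivative.ContMDiffCovariantDerivative D ∞) :
    CovariantDerivative.ContMDiffCovariantDerivative (conj D J hJ) ∞ := by
  refine ⟨⟨fun {Y} hY ↦ ?_⟩⟩
  rw [contMDiffOn_univ] at hY ⊢
  have hY' := ((J.inv hJ).contMDiff.clm_bundle_apply hY)
  have := h.contMDiff.contMDiff (contMDiffOn_univ.mpr hY')
  exact contMDiff_endomorphism_comp J.contMDiff (contMDiffOn_univ.mp this)

end Conj

/-! ### Consequences of J² = ε Id and skewness. -/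

section Kahler

variable {ε : ℝ} {J : EndField m M} {g : PseudoRiemannianMetric m M}

theorem IsEpsKahler.eps_mul_eps (h : IsEpsKahler ε J g) : ε * ε = 1 := by
  rcases h.eps with h | h <;> simp [h]

theorem IsEpsKahler.inv_apply (h : IsEpsKahler ε J g) (x : M) (v : TangentSpace (𝓡 m) x) :
    J.inv h.isInvertible x v = ε • J x v := by
  have := J.inv_apply_self h.isInvertible x (ε • J x v)
  rwa [map_smul, h.sq, smul_smul, h.eps_mul_eps, one_smul] at this

theorem IsEpsKahler.conj_apply (h : IsEpsKahler ε J g) (D : Connection m M)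
    (Y : SmoothVectorField m M) (x : M) (v : TangentSpace (𝓡 m) x) :
    conj D J h.isInvertible Y x v = ε • J x (D (J.apply Y) x v) := by
  have e : (fun y ↦ J.inv h.isInvertible y (Y y)) = ε • ⇑(J.apply Y) :=
    funext fun y ↦ h.inv_apply y _
  -- ε is constant, so it passes through `D` without a derivative term.
  rw [SpecialGeometry.conj_apply, e,
    D.isCovariantDerivativeOnUniv.smul_const ε ((J.apply Y).diffAt x)]
  simp

/-- `∇^J_X Y = ∇_X Y + J⁻¹ (∇_X J) Y`. -/
theorem IsEpsKahler.conj_apply_eq_add (h : IsEpsKahler ε J g) (D : Connection m M)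
    (X Y : SmoothVectorField m M) (x : M) :
    conj D J h.isInvertible Y x (X x) = D Y x (X x) + ε • J x (covDerivEnd D J X Y x) := by
  rw [h.conj_apply, covDerivEnd, map_sub, h.sq, smul_sub, smul_smul, h.eps_mul_eps, one_smul,
    add_sub_cancel]
  rfl

/-- `∇^J J = -∇J`. -/
theorem IsEpsKahler.covDerivEnd_conj (h : IsEpsKahler ε J g) (D : Connection m M)
    (X Y : SmoothVectorField m M) (x : M) :
    covDerivEnd (conj D J h.isInvertible) J X Y x = -covDerivEnd D J X Y x := by
  rw [covDerivEnd, conj_apply_apply, h.conj_apply, map_smul, h.sq, smul_smul, h.eps_mul_eps,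
    one_smul, covDerivEnd, neg_sub]
  rfl

/-- Move one `J` across `g` by skewness and use J² = ε Id. -/
theorem IsEpsKahler.kahlerForm_apply_apply (h : IsEpsKahler ε J g) (x : M)
    (v w : TangentSpace (𝓡 m) x) :
    kahlerForm ε J g x (J x v) (J x w) = -ε * kahlerForm ε J g x v w := by
  simp only [kahlerForm, smul_apply, ContinuousLinearMap.comp_apply, h.sq, map_smul,
    smul_eq_mul, h.skew x v]
  ring

theorem mvfderiv_const_mul {f : M → ℝ} {x : M} (hf : MDifferentiableAt (𝓡 m) 𝓘(ℝ) f x) (c : ℝ) :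
    mvfderiv (𝓡 m) (fun y ↦ c * f y) x = c • mvfderiv (𝓡 m) f x := by
  rw [mvfderiv_fun_mul mdifferentiableAt_const hf, mvfderiv_const]
  simp

/-- Evaluated on JY and JZ, each of the three terms of the covariant derivative has the form ω(J·,
J·) or its derivative, so -ε factors out. -/
theorem IsEpsKahler.covDerivForm_conj (h : IsEpsKahler ε J g) (D : Connection m M)
    (X Y Z : SmoothVectorField m M) (x : M) :
    covDerivForm (conj D J h.isInvertible) (kahlerForm ε J g) X (J.apply Y) (J.apply Z) x
      = -ε * covDerivForm D (kahlerForm ε J g) X Y Z x := by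
  have hd : MDifferentiableAt (𝓡 m) 𝓘(ℝ) (fun y ↦ kahlerForm ε J g y (Y y) (Z y)) x :=
    mdifferentiableAt_const.mul
      (PseudoRiemannianMetric.mdiffAt_inner ((J.apply Y).diffAt x) (Z.diffAt x))
  have e : (fun y ↦ kahlerForm ε J g y (J.apply Y y) (J.apply Z y))
      = fun y ↦ -ε * kahlerForm ε J g y (Y y) (Z y) :=
    funext fun y ↦ h.kahlerForm_apply_apply y _ _
  have hc (W : SmoothVectorField m M) (v : TangentSpace (𝓡 m) x) :
      conj D J h.isInvertible (J.apply W) x v = J x (D W x v) := conj_apply_apply ..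
  have ha (W : SmoothVectorField m M) : J.apply W x = J x (W x) := rfl
  rw [covDerivForm, e, mvfderiv_const_mul hd, hc, hc, ha, ha, h.kahlerForm_apply_apply,
    h.kahlerForm_apply_apply, covDerivForm]
  simp only [smul_apply, smul_eq_mul]
  ring

/-! ### The cone field ξ. -/

/-- If `D` is torsion-free and `Dξ = Id`, then `(D_ξ J) Y = [ξ, JY] - J [ξ, Y]`. -/
theorem covDerivEnd_eq_lieDerivative {D : Connection m M} (hD : D.torsion = 0)
    {ξ : SmoothVectorField m M} (hξ : ∀ (x : M) (v : TangentSpace (𝓡 m) x), D ξ x v = v)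
    (Y : SmoothVectorField m M) (x : M) :
    covDerivEnd D J ξ Y x
      = mlieBracket (𝓡 m) ξ (J.apply Y) x - J x (mlieBracket (𝓡 m) ξ Y x) := by
  rw [← sub_eq_mlieBracket_of_torsion hD, ← sub_eq_mlieBracket_of_torsion hD, hξ, hξ, map_sub,
    covDerivEnd]
  -- The terms D_{JY} ξ = JY and J(D_Y ξ) = JY cancel.
  change _ = D (fun y ↦ J y (Y y)) x (ξ x) - J x (Y x) - _
  abel

/-- On a conical affine special `ε`-Kähler manifold, `∇_ξ J = 0`. -/
theorem IsConicalAffineSpecial.covDerivEnd_xi {nabla : Connection m M}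
    {ξ : SmoothVectorField m M} (h : IsConicalAffineSpecial ε J g nabla ξ)
    (Y : SmoothVectorField m M) (x : M) : covDerivEnd nabla J ξ Y x = 0 := by
  rw [covDerivEnd_eq_lieDerivative h.torsion_free h.nabla_xi,
    ← covDerivEnd_eq_lieDerivative g.leviCivita_torsion h.leviCivita_xi]
  exact h.parallel ξ Y x

theorem IsAffineSpecial.conj [T2Space M] {nabla : Connection m M}
    (h : IsAffineSpecial ε J g nabla) :
    IsAffineSpecial ε J g (conj nabla J h.isInvertible) where
  toIsEpsKahler := h.toIsEpsKahler
  smooth := contMDiff_conj _ _ _ h.smooth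
  flat X Y Z x := by rw [curvature_conj, h.flat, map_zero]
  torsion_free := torsion_eq_zero_of_smooth fun X Y x ↦ by
    rw [h.conj_apply_eq_add, h.conj_apply_eq_add, h.symmetric X Y, add_sub_add_right_eq_sub,
      sub_eq_mlieBracket_of_torsion h.torsion_free]
  symplectic X Y Z x := by
    -- `J` is surjective on smooth fields, so testing on fields JY and JZ suffices.
    have e (W : SmoothVectorField m M) : J.apply ((J.inv h.isInvertible).apply W) = W :=
      ContMDiffSection.ext fun y ↦ J.self_apply_inv h.isInvertible y _
    rw [← e Y, ← e Z, h.covDerivForm_conj, h.symplectic, mul_zero]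
  symmetric X Y x := by rw [h.covDerivEnd_conj, h.covDerivEnd_conj, h.symmetric]

end Kahler

end SpecialGeometry

end

open SpecialGeometry
theorem mainTheorem9 {m : ℕ} {M : Type*} [TopologicalSpace M] [T2Space M]
    [ChartedSpace (EuclideanSpace ℝ (Fin m)) M] [IsManifold (𝓡 m) ∞ M]
    (ε : ℝ) (J : EndField m M) (g : PseudoRiemannianMetric m M) (nabla : Connection m M)
    (ξ : SmoothVectorField m M) (h : IsConicalAffineSpecial ε J g nabla ξ) :
    IsConicalAffineSpecial ε J g (conj nabla J h.isInvertible) ξ where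
  toIsAffineSpecial := h.toIsAffineSpecial.conj
  nabla_xi x v := by
    obtain ⟨X, rfl⟩ := exists_smoothVectorField_eq x v
    -- Symmetry trades (∇_X J)ξ for (∇_ξ J)X, which vanishes.
    rw [h.conj_apply_eq_add, h.symmetric, h.covDerivEnd_xi, h.nabla_xi, map_zero, smul_zero,
      add_zero]
  leviCivita_xi := h.leviCivita_xi
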